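/- Let $\log$ denote the branch of the complex logarithm with branch cut along the negative imaginary axis and $\log 1=0$, and for $a\in\mathbb{R}$ and $w\in\mathbb{C}$ off the cut put $w^a:=\exp(a\log w)$. For real $\alpha>0$ and complex $x$ with $|x|<1$ let $$P(x)^\alpha:=\prod_{m=1}^\infty (1-x^m)^{-\alpha}=\prod_{m=1}^\infty e^{-\alpha\log(1-x^m)},$$ and for integers $h,k$ with $k>0$ let $$s(h,k):=\sum_{r=1}^{k-1}\frac rk\left(\frac{hr}{k}-\left\lfloor\frac{hr}{k}\right\rfloor-\frac12\right)$$ be the Dedekind sum. **Theorem 2.4 (Modified Functional Equation).** Let $z\in\mathbb{C}$ with $\operatorname{Re} z>0$, let $\alpha>0$ be real, and let $h,k,H\in\mathbb{Z}$ with $k>0$, $\gcd(h,k)=1$ and $hH\equiv-1\pmod k$. Put $$x:=\exp\left(\frac{2\pi}{k}\left(ih-\frac zk\right)\right),\qquad x':=\exp\left(\frac{2\pi}{k}\left(iH-\frac kz\right)\right).$$ Then the products defining $P(x)^\alpha$ and $P(x')^\alpha$ converge, and $$P(x)^\alpha=e^{\pi i\alpha s(h,k)}\left(\frac zk\right)^{\alpha/2}\exp\left(\frac{\alpha\pi}{12k}\left(\frac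 kz-\frac zk\right)\right)P(x')^\alpha.$$ -/

import Mathlib

noncomputable section

/-- The branch of the complex logarithm with branch cut along the negative imaginary axis and
`logBranch 1 = 0`; its argument lies in `(-π/2, 3π/2]`. -/
def logBranch (w : ℂ) : ℂ :=
  Complex.log (-Complex.I * w) + (Real.pi / 2 : ℝ) * Complex.I

/-- The real power `w ^ a := exp (a * log w)` for the above branch of the logarithm (`w ≠ 0`). -/
def powBranch (w : ℂ) (a : ℝ) : ℂ :=
  Complex.exp ((a : ℂ) * logBranch w)

/-- The `n`-th factor `(1 - x ^ (n + 1)) ^ (-α)`, `n = 0, 1, 2, …`, of the product `P(x)^α`. -/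
def genFactor (α : ℝ) (x : ℂ) (n : ℕ) : ℂ :=
  powBranch (1 - x ^ (n + 1)) (-α)

/-- `P(x)^α = ∏_{m ≥ 1} (1 - x ^ m) ^ (-α)`, for `x` in the open unit disk. -/
def partitionGenPow (α : ℝ) (x : ℂ) : ℂ :=
  ∏' n : ℕ, genFactor α x n

/-- The Dedekind sum `s(h, k) = ∑_{r = 1}^{k - 1} (r / k) (h r / k - ⌊h r / k⌋ - 1 / 2)`. -/
def dedekindSum (h k : ℤ) : ℝ :=
  ∑ r ∈ Finset.Icc 1 (k - 1),
    (r : ℝ) / k * ((h : ℝ) * r / k - (⌊(h : ℝ) * r / k⌋ : ℝ) - 1 / 2)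

end

/-!
Write `x = exp (2πi τ)` with `τ = (h + i w) / k` and `w = z / k`; then `x' = exp (2πi τ')` with
`τ' = (H + i / w) / k`, the image of `τ` under an element of the modular group. The products
converge because `∑ log (1 - x ^ m)` does (`hasProd_genFactor`), and since the exponent `α` is an
arbitrary real number, the functional equation amounts to an exact transformation formula for the
sum `eulerLog x` of these logarithms, with no ambiguity modulo `2πi` (`eulerLog_transformation`).

For `τ = i w` and `τ' = i / w` the formula holds modulo `2πi` by Mathlib's transformation formula
for the Dedekind eta function under `S`; both sides are continuous on the right half-plane and agree
at `w = 1`, so it holds exactly (`eulerLog_inversion`). The general case follows from this one by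
the Euclidean algorithm: `eulerLog (exp (2πi τ))` is invariant under `τ ↦ τ + 1`, so one may take
`0 < h < k`, and `τ ↦ -1 / τ` turns the pair `(h, k)` into `(-k, h)` without changing `τ'`. The
constants match by the reciprocity law for Dedekind sums (`dedekindSum_reciprocity`), which comes
from counting lattice points on the two sides of a line.
-/

/-! ### The logarithm of Euler's product -/

/-- The logarithm `∑ log (1 - x ^ m)` of Euler's product `∏ (1 - x ^ m)`, `m ≥ 1`, each term being
the principal logarithm; it is continuous on the open unit disk. -/
noncomputable def eulerLog (x : ℂ) : ℂ :=
  ∑' n : ℕ, Complex.log (1 - x ^ (n + 1))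

lemma re_one_sub_pow_pos {x : ℂ} (hx : ‖x‖ < 1) (n : ℕ) : 0 < (1 - x ^ (n + 1)).re := by
  have h1 : ‖x ^ (n + 1)‖ < 1 := by
    rw [norm_pow]
    exact pow_lt_one₀ (norm_nonneg _) hx (by omega)
  have h2 := (Complex.abs_re_le_norm (x ^ (n + 1))).trans_lt h1
  rw [Complex.sub_re, Complex.one_re]
  linarith [(abs_lt.mp h2).2]

lemma one_sub_pow_ne_zero {x : ℂ} (hx : ‖x‖ < 1) (n : ℕ) : 1 - x ^ (n + 1) ≠ 0 := fun h ↦ by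
  simpa [h] using re_one_sub_pow_pos hx n

lemma summable_log_one_sub_pow {x : ℂ} (hx : ‖x‖ < 1) :
    Summable fun n : ℕ ↦ Complex.log (1 - x ^ (n + 1)) := by
  have : Summable fun n : ℕ ↦ -x ^ (n + 1) :=
    ((summable_nat_add_iff (f := fun n ↦ x ^ n) 1).mpr
      (summable_geometric_of_norm_lt_one hx)).neg
  simpa [sub_eq_add_neg] using Complex.summable_log_one_add_of_summable this

lemma exp_eulerLog {x : ℂ} (hx : ‖x‖ < 1) :
    Complex.exp (eulerLog x) = ∏' n : ℕ, (1 - x ^ (n + 1)) :=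
  Complex.cexp_tsum_eq_tprod (one_sub_pow_ne_zero hx) (summable_log_one_sub_pow hx)

lemma norm_log_one_sub_pow_le {x : ℂ} {r : ℝ} (hr : r < 1) (hx : ‖x‖ ≤ r) (n : ℕ) :
    ‖Complex.log (1 - x ^ (n + 1))‖ ≤ r ^ (n + 1) * ((1 - r)⁻¹ / 2 + 1) := by
  have h0 : 0 ≤ r := (norm_nonneg _).trans hx
  have h1 : ‖-x ^ (n + 1)‖ ≤ r ^ (n + 1) := by
    rw [norm_neg, norm_pow]
    exact pow_le_pow_left₀ (norm_nonneg _) hx _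
  have h2 : r ^ (n + 1) ≤ r := pow_le_of_le_one h0 hr.le (by omega)
  have h3 := Complex.norm_log_one_add_le (z := -x ^ (n + 1)) (by linarith)
  rw [← sub_eq_add_neg] at h3
  refine h3.trans ?_
  have h4 : (1 - ‖-x ^ (n + 1)‖)⁻¹ ≤ (1 - r)⁻¹ :=
    inv_anti₀ (by linarith) (by linarith)
  have h5 : ‖-x ^ (n + 1)‖ ^ 2 ≤ r ^ (n + 1) := by
    calc ‖-x ^ (n + 1)‖ ^ 2 ≤ ‖-x ^ (n + 1)‖ ^ 1 :=
          pow_le_pow_of_le_one (norm_nonneg _) (by linarith) (by omega)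
      _ ≤ _ := by simpa using h1
  have h6 : 0 ≤ (1 - ‖-x ^ (n + 1)‖)⁻¹ := inv_nonneg.mpr (by linarith)
  have h7 : ‖-x ^ (n + 1)‖ ^ 2 * (1 - ‖-x ^ (n + 1)‖)⁻¹ ≤ r ^ (n + 1) * (1 - r)⁻¹ :=
    mul_le_mul h5 h4 h6 (by positivity)
  linarith

lemma continuousOn_eulerLog : ContinuousOn eulerLog (Metric.ball 0 1) := by
  intro x hx
  rw [mem_ball_zero_iff] at hx
  obtain ⟨r, hxr, hr⟩ := exists_between hx
  have h0 : 0 ≤ r := (norm_nonneg _).trans hxr.le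
  have key : ContinuousOn eulerLog (Metric.ball 0 r) := by
    refine continuousOn_tsum (u := fun n ↦ r ^ (n + 1) * ((1 - r)⁻¹ / 2 + 1)) (fun n ↦ ?_)
      (((summable_nat_add_iff (f := fun n ↦ r ^ n) 1).mpr
        (summable_geometric_of_lt_one h0 hr)).mul_right _)
      fun n y hy ↦ norm_log_one_sub_pow_le hr (mem_ball_zero_iff.mp hy).le n
    refine ContinuousOn.clog (by fun_prop) fun y hy ↦ ?_
    exact Or.inl (re_one_sub_pow_pos ((mem_ball_zero_iff.mp hy).trans hr) n)
  exact (key.continuousAt (Metric.isOpen_ball.mem_nhds (by simpa using hxr))).continuousWithinAt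

/-- On the right half-plane the branch with cut along the negative imaginary axis is the principal
branch. -/
lemma logBranch_eq_log {w : ℂ} (hw : 0 < w.re) : logBranch w = Complex.log w := by
  have hw0 : w ≠ 0 := fun h ↦ by simp [h] at hw
  have harg := Complex.abs_arg_lt_pi_div_two_iff.mpr (Or.inl hw)
  rw [abs_lt] at harg
  rw [logBranch, Complex.log_mul (by simp) hw0, Complex.log_neg_I]
  · push_cast; ring
  · rw [Complex.arg_neg_I]
    constructor <;> linarith [Real.pi_pos]

lemma genFactor_eq_exp {x : ℂ} (hx : ‖x‖ < 1) (α : ℝ) (n : ℕ) :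
    genFactor α x n = Complex.exp (-α * Complex.log (1 - x ^ (n + 1))) := by
  rw [genFactor, powBranch, logBranch_eq_log (re_one_sub_pow_pos hx n)]
  push_cast; rfl

lemma hasProd_genFactor {x : ℂ} (hx : ‖x‖ < 1) (α : ℝ) :
    HasProd (genFactor α x) (Complex.exp (-α * eulerLog x)) := by
  rw [funext (genFactor_eq_exp hx α)]
  exact ((summable_log_one_sub_pow hx).hasSum.mul_left (-α : ℂ)).cexp

/-! ### Inversion -/

lemma norm_exp_two_pi_I_mul_lt_one {τ : ℂ} (hτ : 0 < τ.im) :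
    ‖Complex.exp (2 * Real.pi * Complex.I * τ)‖ < 1 :=
  UpperHalfPlane.norm_exp_two_pi_I_lt_one ⟨τ, hτ⟩

lemma eta_eq_exp {τ : ℂ} (hτ : 0 < τ.im) :
    ModularForm.eta τ = Complex.exp (Real.pi * Complex.I * τ / 12 +
      eulerLog (Complex.exp (2 * Real.pi * Complex.I * τ))) := by
  rw [Complex.exp_add, exp_eulerLog (norm_exp_two_pi_I_mul_lt_one hτ), ModularForm.eta]
  congr 1
  · rw [Function.Periodic.qParam]
    congr 1
    push_cast; ring
  · simp_rw [ModularForm.eta_q_eq_pow]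

/-- A continuous function with values in `2πi ℤ` on a preconnected set vanishes as soon as it has
a zero. -/
lemma eq_zero_of_exp_eq_one {s : Set ℂ} (hs : IsPreconnected s) {f : ℂ → ℂ}
    (hf : ContinuousOn f s) (hexp : ∀ w ∈ s, Complex.exp (f w) = 1) {a w : ℂ} (ha : a ∈ s)
    (hfa : f a = 0) (hw : w ∈ s) : f w = 0 := by
  have hpi := Real.pi_ne_zero
  have key : ∀ w ∈ s, ∃ n : ℤ, f w = n * (2 * Real.pi * Complex.I) := fun w hw ↦
    Complex.exp_eq_one_iff.mp (hexp w hw)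
  have hg : ContinuousOn (fun w ↦ (f w).im / (2 * Real.pi)) s :=
    (Complex.continuous_im.comp_continuousOn hf).div_const _
  have hmaps : Set.MapsTo (fun w ↦ (f w).im / (2 * Real.pi)) s (Set.range ((↑) : ℤ → ℝ)) := by
    intro w hw
    obtain ⟨n, hn⟩ := key w hw
    refine ⟨n, ?_⟩
    simp [hn]
  have := hs.constant_of_mapsTo
    (Topology.IsInducing.isDiscrete_range Real.isClosedEmbedding_intCast.isInducing) hg hmaps hw ha
  obtain ⟨n, hn⟩ := key w hw
  simp only [hn, hfa] at this
  have hn0 : n = 0 := by simpa [hpi] using this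
  simp [hn, hn0]

lemma log_I_mul {w : ℂ} (hw : 0 < w.re) :
    Complex.log (Complex.I * w) = Complex.log w + Real.pi / 2 * Complex.I := by
  have hw0 : w ≠ 0 := fun h ↦ by simp [h] at hw
  have harg := Complex.abs_arg_lt_pi_div_two_iff.mpr (Or.inl hw)
  rw [abs_lt] at harg
  rw [Complex.log_mul Complex.I_ne_zero hw0, Complex.log_I, add_comm]
  rw [Complex.arg_I]
  constructor <;> linarith [Real.pi_pos]

lemma re_inv_pos {w : ℂ} (hw : 0 < w.re) : 0 < w⁻¹.re := by
  rw [Complex.inv_re]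
  exact div_pos hw (Complex.normSq_pos.mpr fun h ↦ by simp [h] at hw)

/-- The inversion formula for `log η`, without the ambiguity modulo `2πi`: both sides are
continuous in `w` and agree at `w = 1`. -/
lemma eulerLog_inversion {w : ℂ} (hw : 0 < w.re) :
    eulerLog (Complex.exp (2 * Real.pi * Complex.I * (Complex.I * w⁻¹))) =
      eulerLog (Complex.exp (2 * Real.pi * Complex.I * (Complex.I * w))) +
        Complex.log w / 2 + Real.pi / 12 * (w⁻¹ - w) := by
  set f : ℂ → ℂ := fun w ↦
    eulerLog (Complex.exp (2 * Real.pi * Complex.I * (Complex.I * w⁻¹))) -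
      (eulerLog (Complex.exp (2 * Real.pi * Complex.I * (Complex.I * w))) +
        Complex.log w / 2 + Real.pi / 12 * (w⁻¹ - w)) with hfdef
  have him : ∀ {w : ℂ}, 0 < w.re → 0 < (Complex.I * w).im := fun hw ↦ by simpa using hw
  have hs : IsPreconnected {w : ℂ | 0 < w.re} := (convex_halfSpace_re_gt 0).isPreconnected
  have hinv : ContinuousOn (fun w : ℂ ↦ w⁻¹) {w : ℂ | 0 < w.re} :=
    continuousOn_inv₀.mono fun w hw h ↦ by simp_all
  have hf : ContinuousOn f {w : ℂ | 0 < w.re} := by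
    refine .sub ?_ (.add (.add ?_ ?_) ?_)
    · refine continuousOn_eulerLog.comp (by fun_prop) fun w hw ↦ ?_
      exact mem_ball_zero_iff.mpr (norm_exp_two_pi_I_mul_lt_one (him (re_inv_pos hw)))
    · refine continuousOn_eulerLog.comp (by fun_prop) fun w hw ↦ ?_
      exact mem_ball_zero_iff.mpr (norm_exp_two_pi_I_mul_lt_one (him hw))
    · exact (continuousOn_id.clog fun w hw ↦ Or.inl hw).div_const _
    · fun_prop
  have hexp : ∀ w ∈ {w : ℂ | 0 < w.re}, Complex.exp (f w) = 1 := by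
    intro w hw
    have hw0 : w ≠ 0 := fun h ↦ by simp [h] at hw
    have hS := ModularForm.eta_comp_eq_csqrt_I_inv (him hw)
    have hneg : -1 / (Complex.I * w) = Complex.I * w⁻¹ := by
      field_simp; simp
    simp only [Function.comp_apply, Pi.smul_apply, Pi.mul_apply, smul_eq_mul] at hS
    rw [hneg, eta_eq_exp (him hw), eta_eq_exp (him (re_inv_pos hw)),
      sqrt_eq_exp Complex.I_ne_zero,
      sqrt_eq_exp (mul_ne_zero Complex.I_ne_zero hw0), log_I_mul hw, Complex.log_I,
      ← Complex.exp_neg, ← Complex.exp_add, ← Complex.exp_add] at hS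
    have h1 := div_eq_one_iff_eq (Complex.exp_ne_zero _) |>.mpr hS
    rw [← Complex.exp_sub] at h1
    rw [← h1, hfdef]
    congr 1
    linear_combination (Real.pi * (w⁻¹ - w) / 12 : ℂ) * (-1 : ℂ) * (Complex.I_sq)
  have h1 : f 1 = 0 := by simp [hfdef]
  exact sub_eq_zero.mp (eq_zero_of_exp_eq_one hs hf hexp (a := 1) (by simp) h1 hw)

/-! ### Dedekind sums -/

open Finset in
lemma dedekindSum_eq_sum_range (h : ℤ) {k : ℕ} (hk : 0 < k) :
    dedekindSum h k = ∑ r ∈ range k, (r : ℝ) / k * (((h * r % k : ℤ) : ℝ) / k - 1 / 2) := by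
  have hterm : ∀ r : ℕ, (r : ℝ) / k * ((h : ℝ) * r / k - (⌊(h : ℝ) * r / k⌋ : ℝ) - 1 / 2) =
      (r : ℝ) / k * (((h * r % k : ℤ) : ℝ) / k - 1 / 2) := by
    intro r
    have := Int.fract_div_intCast_eq_div_intCast_mod (k := ℝ) (m := h * r) (n := k)
    rw [← this, Int.fract]
    push_cast; rfl
  have himg : Icc (1 : ℤ) ((k : ℤ) - 1) = (Ico 1 k).image (Nat.cast : ℕ → ℤ) := by
    ext a
    simp only [mem_Icc, mem_image, mem_Ico]
    constructor
    · intro ha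
      exact ⟨a.toNat, by omega, by omega⟩
    · rintro ⟨b, hb, rfl⟩
      omega
  rw [dedekindSum, himg, sum_image (by intro a _ b _ hab; exact_mod_cast hab),
    range_eq_Ico, sum_eq_sum_Ico_succ_bot hk]
  simp only [Int.cast_natCast, hterm]
  simp

lemma dedekindSum_congr {h h' : ℤ} {k : ℕ} (hk : 0 < k) (hh : h ≡ h' [ZMOD k]) :
    dedekindSum h k = dedekindSum h' k := by
  rw [dedekindSum_eq_sum_range h hk, dedekindSum_eq_sum_range h' hk]
  refine Finset.sum_congr rfl fun r _ ↦ ?_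
  rw [(hh.mul_right r : h * r % k = h' * r % k)]

lemma dedekindSum_neg {h : ℤ} {k : ℕ} (hk : 0 < k) (hhk : IsCoprime h (k : ℤ)) :
    dedekindSum (-h) k = -dedekindSum h k := by
  rw [dedekindSum_eq_sum_range _ hk, dedekindSum_eq_sum_range _ hk, ← Finset.sum_neg_distrib]
  refine Finset.sum_congr rfl fun r hr ↦ ?_
  rcases r.eq_zero_or_pos with rfl | hr0
  · simp
  have hk' : (k : ℝ) ≠ 0 := by positivity
  have hnd : h * r % k ≠ 0 := fun hz ↦ by
    have h1 : (k : ℤ) ∣ r := hhk.symm.dvd_of_dvd_mul_left (Int.dvd_of_emod_eq_zero hz)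
    have h2 := Int.le_of_dvd (by omega) h1
    have h3 := Finset.mem_range.mp hr
    omega
  have hmod : -h * r % k = k - h * r % k := by
    have h1 := Int.emod_nonneg (h * r) (b := k) (by omega)
    have h2 := Int.emod_lt_of_pos (h * r) (b := k) (by omega)
    rw [← Int.emod_eq_of_lt (a := k - h * r % k) (b := k) (by omega) (by omega)]
    refine Int.ModEq.symm ((Int.modEq_iff_dvd).mpr ⟨-(h * r / k) - 1, ?_⟩)
    have := Int.emod_add_mul_ediv (h * r) k
    linear_combination this
  rw [hmod]
  push_cast
  field_simp
  ring

open Finset in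
lemma sum_range_mul_mod {h k : ℕ} (hk : 0 < k) (hhk : h.Coprime k) (g : ℕ → ℝ) :
    ∑ r ∈ range k, g (h * r % k) = ∑ r ∈ range k, g r := by
  have hmaps : ∀ r ∈ range k, h * r % k ∈ range k := fun r _ ↦ mem_range.mpr (Nat.mod_lt _ hk)
  have hinj : Set.InjOn (fun r ↦ h * r % k) (range k : Set ℕ) := by
    intro a ha b hb hab
    have h1 : a ≡ b [MOD k] := Nat.ModEq.cancel_left_of_coprime (Nat.coprime_comm.mp hhk) hab
    exact h1.eq_of_lt_of_lt (by simpa using ha) (by simpa using hb)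
  refine sum_bij (fun r _ ↦ h * r % k) hmaps (fun a ha b hb hab ↦ hinj (by simpa using ha)
    (by simpa using hb) hab) (fun b hb ↦ ?_) fun _ _ ↦ rfl
  obtain ⟨a, ha, hab⟩ := surj_on_of_inj_on_of_card_le (fun r _ ↦ h * r % k) hmaps
    (fun a b ha hb hab ↦ hinj (by simpa using ha) (by simpa using hb) hab) le_rfl b hb
  exact ⟨a, ha, hab.symm⟩

lemma sum_range_cast (n : ℕ) : ∑ j ∈ Finset.range n, (j : ℝ) = n * (n - 1) / 2 := by
  induction n with
  | zero => simp
  | succ n ih => rw [Finset.sum_range_succ, ih]; push_cast; ring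

lemma sum_range_cast_sq (n : ℕ) :
    ∑ j ∈ Finset.range n, (j : ℝ) ^ 2 = n * (n - 1) * (2 * n - 1) / 6 := by
  induction n with
  | zero => simp
  | succ n ih => rw [Finset.sum_range_succ, ih]; push_cast; ring

open Finset in
/-- Summing `r` over the lattice points `(r, j)` with `0 < j < h`, `r < k` below the line
`k j = h r`, first along columns and then along rows. -/
lemma sum_mul_div_add_sum_div {h k : ℕ} (hh : 0 < h) (hk : 0 < k) (hhk : h.Coprime k) :
    2 * ∑ r ∈ range k, (r : ℝ) * (h * r / k : ℕ) +
      ∑ j ∈ range h, (((k * j / h : ℕ) : ℝ) ^ 2 + (k * j / h : ℕ)) = (h - 1) * (k * (k - 1)) := by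
  have hcol : ∀ r ∈ range k, (r : ℝ) * (h * r / k : ℕ) =
      ∑ j ∈ Ico 1 h, if k * j ≤ h * r then (r : ℝ) else 0 := by
    intro r hr
    have hf : (Ico 1 h).filter (fun j ↦ k * j ≤ h * r) = Ico 1 (h * r / k + 1) := by
      ext j
      have h1 : j ≤ h * r / k ↔ k * j ≤ h * r := by
        rw [Nat.le_div_iff_mul_le hk, mul_comm]
      have h2 : h * r / k < h := by
        rw [Nat.div_lt_iff_lt_mul hk]
        exact Nat.mul_lt_mul_of_pos_left (mem_range.mp hr) hh
      simp only [mem_filter, mem_Ico, ← h1]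
      omega
    rw [← sum_filter, hf, sum_const, Nat.card_Ico, nsmul_eq_mul, mul_comm]
    simp
  have hrow : ∀ j ∈ Ico 1 h, 2 * (∑ r ∈ range k, if k * j ≤ h * r then (r : ℝ) else 0) =
      k * (k - 1) - (((k * j / h : ℕ) : ℝ) ^ 2 + (k * j / h : ℕ)) := by
    intro j hj
    obtain ⟨hj1, hj2⟩ := mem_Ico.mp hj
    have hq : k * j / h < k := by
      rw [Nat.div_lt_iff_lt_mul hh]
      exact Nat.mul_lt_mul_of_pos_left hj2 hk
    -- coprimality excludes lattice points on the line itself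
    have hiff : ∀ r, k * j ≤ h * r ↔ ¬ r < k * j / h + 1 := by
      intro r
      rw [not_lt, Nat.add_one_le_iff, Nat.div_lt_iff_lt_mul hh, mul_comm r h]
      refine ⟨fun hle ↦ hle.lt_of_ne fun heq ↦ ?_, le_of_lt⟩
      have : h ∣ j := hhk.dvd_of_dvd_mul_left ⟨r, heq⟩
      exact absurd (Nat.le_of_dvd hj1 this) (by omega)
    have hsplit := sum_range_add_sum_Ico (fun r ↦ (r : ℝ)) (show k * j / h + 1 ≤ k from hq)
    have hf : (range k).filter (fun r ↦ k * j ≤ h * r) = Ico (k * j / h + 1) k := by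
      ext r
      simp only [mem_filter, mem_range, mem_Ico, hiff]
      omega
    rw [← sum_filter, hf]
    rw [sum_range_cast, sum_range_cast] at hsplit
    push_cast at hsplit ⊢
    linear_combination 2 * hsplit
  rw [sum_congr rfl hcol, sum_comm, mul_sum, sum_congr rfl hrow, sum_sub_distrib, range_eq_Ico,
    sum_eq_sum_Ico_succ_bot hh]
  simp [Nat.cast_sub (show 1 ≤ h from hh)]

open Finset in
/-- Dedekind's reciprocity law. -/
lemma dedekindSum_reciprocity {h k : ℕ} (hh : 0 < h) (hk : 0 < k) (hhk : h.Coprime k) :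
    dedekindSum h k + dedekindSum k h = -1 / 4 + ((h : ℝ) ^ 2 + k ^ 2 + 1) / (12 * h * k) := by
  have hk' : (k : ℝ) ≠ 0 := by positivity
  have hh' : (h : ℝ) ≠ 0 := by positivity
  have hmod : ∀ a b : ℕ, ((a % b : ℕ) : ℝ) = a - b * (a / b : ℕ) := fun a b ↦ by
    rw [eq_sub_iff_add_eq]
    exact_mod_cast Nat.mod_add_div a b
  have hs : ∀ h k : ℕ, 0 < k → dedekindSum h k =
      (h * (∑ r ∈ range k, (r : ℝ) ^ 2) - k * ∑ r ∈ range k, (r : ℝ) * (h * r / k : ℕ)) / k ^ 2 -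
        (∑ r ∈ range k, (r : ℝ)) / (2 * k) := by
    intro h k hk
    have hk' : (k : ℝ) ≠ 0 := by positivity
    rw [dedekindSum_eq_sum_range _ hk, mul_sum, mul_sum, ← sum_sub_distrib, sum_div, sum_div,
      ← sum_sub_distrib]
    refine sum_congr rfl fun r _ ↦ ?_
    have : (((h : ℤ) * r % k : ℤ) : ℝ) = ((h * r % k : ℕ) : ℝ) := by norm_cast
    rw [this, hmod]
    push_cast
    field_simp
  -- `j ↦ k * j % h` permutes the residues modulo `h`
  have h1 := sum_range_mul_mod hh hhk.symm fun n ↦ (n : ℝ)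
  have h2 := sum_range_mul_mod hh hhk.symm fun n ↦ (n : ℝ) ^ 2
  have h3 := sum_mul_div_add_sum_div hh hk hhk
  simp only [hmod, sub_sq, mul_pow, sum_add_distrib, sum_sub_distrib, Nat.cast_mul,
    ← mul_sum, sum_range_cast, sum_range_cast_sq] at h1 h2 h3
  have hA : ∑ j ∈ range h, 2 * ((k : ℝ) * j) * (h * (k * j / h : ℕ)) =
      2 * k * h * ∑ j ∈ range h, (j : ℝ) * (k * j / h : ℕ) := by
    rw [mul_sum]
    exact sum_congr rfl fun _ _ ↦ by ring
  rw [hA] at h2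
  rw [hs h k hk, hs k h hh, sum_range_cast, sum_range_cast, sum_range_cast_sq, sum_range_cast_sq]
  generalize ∑ j ∈ range h, (j : ℝ) * (k * j / h : ℕ) = A at *
  generalize ∑ r ∈ range k, (r : ℝ) * (h * r / k : ℕ) = B at *
  generalize ∑ j ∈ range h, ((k * j / h : ℕ) : ℝ) ^ 2 = Q₂ at *
  generalize ∑ j ∈ range h, ((k * j / h : ℕ) : ℝ) = Q₁ at *
  have eQ : Q₁ = (k - 1) * (h - 1) / 2 := by
    apply mul_left_cancel₀ hh'
    linear_combination -h1
  have eB : B = ((h - 1) * (k * (k - 1)) - Q₂ - Q₁) / 2 := by linear_combination h3 / 2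
  have eA : A = (k ^ 2 * (h * (h - 1) * (2 * h - 1) / 6) + h ^ 2 * Q₂ -
      h * (h - 1) * (2 * h - 1) / 6) / (2 * k * h) := by
    rw [eq_div_iff (by positivity)]
    linear_combination -h2
  rw [eA, eB, eQ]
  field_simp
  ring

/-! ### The general transformation formula -/

lemma log_mul_of_re_pos {w v : ℂ} (hw : 0 < w.re) (hv : 0 < v.re) :
    Complex.log (w * v) = Complex.log w + Complex.log v := by
  have hw1 := abs_lt.mp (Complex.abs_arg_lt_pi_div_two_iff.mpr (Or.inl hw))
  have hv1 := abs_lt.mp (Complex.abs_arg_lt_pi_div_two_iff.mpr (Or.inl hv))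
  refine Complex.log_mul (fun h ↦ by simp [h] at hw) (fun h ↦ by simp [h] at hv) ?_
  constructor <;> linarith

lemma exp_two_pi_I_mul_congr {a b : ℂ} (t : ℤ) (h : a = b + t) :
    Complex.exp (2 * Real.pi * Complex.I * a) = Complex.exp (2 * Real.pi * Complex.I * b) := by
  rw [Complex.exp_eq_exp_iff_exists_int]
  exact ⟨t, by rw [h]; ring⟩

/-- The transformation formula for `log η` under a general element of the modular group, as an
equality of complex numbers rather than one modulo `2πi`. The induction on `k` runs the Euclidean
algorithm on `(k, h)`: after reducing `h` modulo `k`, the inversion `τ ↦ -1 / τ` leads from the pair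
`(h, k)` to `(-k, h)`, and the reciprocity law accounts for the constants. -/
lemma eulerLog_transformation (k : ℕ) (hk : 0 < k) (h H : ℤ) (hH : h * H ≡ -1 [ZMOD k])
    {w : ℂ} (hw : 0 < w.re) :
    eulerLog (Complex.exp (2 * Real.pi * Complex.I * ((h + Complex.I * w) / k))) =
      eulerLog (Complex.exp (2 * Real.pi * Complex.I * ((H + Complex.I * w⁻¹) / k))) -
        Complex.log w / 2 - Real.pi / (12 * k) * (w⁻¹ - w) -
        Real.pi * Complex.I * dedekindSum h k := by
  induction k using Nat.strong_induction_on generalizing h H w with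
  | _ k ih =>
    have hw0 : w ≠ 0 := fun h ↦ by simp [h] at hw
    obtain rfl | hk1 := (Nat.one_le_iff_ne_zero.mpr hk.ne').eq_or_lt
    · rw [exp_two_pi_I_mul_congr (a := (h + Complex.I * w) / (1 : ℕ)) (b := Complex.I * w) h
        (by simp; ring), exp_two_pi_I_mul_congr (a := (H + Complex.I * w⁻¹) / (1 : ℕ))
        (b := Complex.I * w⁻¹) H (by simp; ring), eulerLog_inversion hw]
      have : dedekindSum h (1 : ℕ) = 0 := by simp [dedekindSum]
      rw [this]
      push_cast
      ring
    · have hk0 : (k : ℂ) ≠ 0 := by exact_mod_cast hk.ne'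
      obtain ⟨m, hm⟩ := Int.eq_ofNat_of_zero_le (Int.emod_nonneg h (b := k) (by omega))
      have hmk : m < k := by
        have := Int.emod_lt_of_pos h (b := k) (by omega)
        omega
      have hmh : h ≡ m [ZMOD k] := by rw [← hm]; exact (Int.mod_modEq h k).symm
      -- the companion of `-k` modulo `m`
      obtain ⟨H', hH'⟩ : ∃ H' : ℤ, m * H + 1 = k * H' := by
        obtain ⟨c, hc⟩ := ((hmh.symm.mul_right H).trans hH).symm.dvd
        exact ⟨c, by linear_combination hc⟩
      have hm0 : 0 < m := by
        rcases m.eq_zero_or_pos with rfl | hpos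
        · have : (k : ℤ) ∣ 1 := ⟨H', by simpa using hH'⟩
          have := Int.le_of_dvd one_pos this
          omega
        · exact hpos
      have hmc : (m : ℂ) ≠ 0 := by exact_mod_cast hm0.ne'
      have hcop : IsCoprime (k : ℤ) (m : ℤ) := ⟨H', -H, by linear_combination -hH'⟩
      obtain ⟨t, ht⟩ := hmh.symm.dvd
      -- the reduced point is `I * u`, and `-1 / (I * u) = (-k + I * v⁻¹) / m`
      set u : ℂ := (w - Complex.I * m) / k with hu
      set v : ℂ := (m * w⁻¹ + Complex.I) / k with hv
      have hure : 0 < u.re := by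
        rw [hu, Complex.div_natCast_re]
        simpa using div_pos hw (by exact_mod_cast hk)
      have hvre : 0 < v.re := by
        rw [hv, Complex.div_natCast_re]
        refine div_pos ?_ (by exact_mod_cast hk)
        have : 0 < (m : ℝ) * (w⁻¹).re := mul_pos (by exact_mod_cast hm0) (re_inv_pos hw)
        simpa only [Complex.add_re, Complex.I_re, add_zero, Complex.mul_re, Complex.natCast_re,
          Complex.natCast_im, zero_mul, sub_zero] using this
      have hu0 : u ≠ 0 := fun h ↦ by simp [h] at hure
      have hv0 : v ≠ 0 := fun h ↦ by simp [h] at hvre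
      have huv : Complex.I * u = w * v := by
        rw [hu, hv]
        field_simp
        linear_combination (-m : ℂ) * Complex.I_sq
      -- `I * u` is written as a product of two factors in the right half-plane, whose arguments add
      -- up to less than `π` in absolute value
      have hlog : Complex.log u + Real.pi / 2 * Complex.I = Complex.log w + Complex.log v := by
        rw [← log_I_mul hure, huv, log_mul_of_re_pos hw hvre]
      have hlogv : Complex.log v⁻¹ = -Complex.log v := by
        refine Complex.log_inv _ fun h ↦ ?_
        have := abs_lt.mp (Complex.abs_arg_lt_pi_div_two_iff.mpr (Or.inl hvre))
        linarith [Real.pi_pos]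
      have e1 : (h + Complex.I * w) / k = Complex.I * u + t := by
        have : (h : ℂ) = m + k * t := by
          have : h = m + k * t := by linear_combination ht
          exact_mod_cast this
        rw [this, hu]
        field_simp
        linear_combination (m : ℂ) * Complex.I_sq
      have h1 : u⁻¹ = Complex.I * w⁻¹ * v⁻¹ := by
        field_simp
        linear_combination -huv
      have e2 : Complex.I * u⁻¹ = (((-k : ℤ) : ℂ) + Complex.I * v⁻¹) / m := by
        have h2 : (m : ℂ) = w * (k * v - Complex.I) := by
          rw [hv]; field_simp; ring
        rw [h1, eq_div_iff hmc, h2]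
        push_cast
        field_simp
        linear_combination (k * v - Complex.I) * Complex.I_sq
      have e3 : (H' + Complex.I * v⁻¹⁻¹) / m = (H + Complex.I * w⁻¹) / k := by
        have : (m * H + 1 : ℂ) = k * H' := by exact_mod_cast hH'
        rw [inv_inv, hv, div_eq_div_iff hmc hk0]
        field_simp
        linear_combination -w * this + w * Complex.I_sq
      have hIH := ih m hmk hm0 (-k) H' (Int.modEq_iff_dvd.mpr ⟨H, by linear_combination -hH'⟩)
        (re_inv_pos hvre)
      have hS := eulerLog_inversion hure
      have hrec := dedekindSum_reciprocity hm0 hk (Nat.isCoprime_iff_coprime.mp hcop.symm)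
      have hrecC : (dedekindSum m k + dedekindSum k m : ℂ) =
          -1 / 4 + ((m : ℂ) ^ 2 + k ^ 2 + 1) / (12 * m * k) := by
        have := congrArg (fun x : ℝ ↦ (x : ℂ)) hrec
        push_cast at this
        exact this
      rw [e3, ← e2, hlogv, dedekindSum_neg hm0 hcop] at hIH
      rw [exp_two_pi_I_mul_congr t e1, dedekindSum_congr hk hmh]
      have hrat : (1 / 12 * (u⁻¹ - u) + 1 / (12 * m) * (v - v⁻¹) : ℂ) =
          1 / (12 * k) * (w⁻¹ - w) + Complex.I * ((m : ℂ) ^ 2 + k ^ 2 + 1) / (12 * m * k) := by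
        have hA : Complex.I * w⁻¹ * v⁻¹ - v⁻¹ / m = Complex.I * k / m := by
          have hkv : k * (w * v) = m + Complex.I * w := by
            rw [hv]; field_simp
          clear_value v
          field_simp
          linear_combination -Complex.I * hkv - w * Complex.I_sq
        have hB : Complex.I * w * v + v / m =
            w⁻¹ / k - w / k + Complex.I * (m ^ 2 + 1) / (m * k) := by
          rw [hv]
          field_simp
          linear_combination w ^ 2 * m * Complex.I_sq
        have h3 : u = -Complex.I * (w * v) := by
          rw [← huv]
          linear_combination u * Complex.I_sq
        rw [h1, h3]
        have hC : Complex.I * ((m : ℂ) ^ 2 + k ^ 2 + 1) / (12 * m * k) =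
            (Complex.I * k / m + Complex.I * (m ^ 2 + 1) / (m * k)) / 12 := by
          field_simp
          ring
        rw [hC]
        linear_combination (hA + hB) / 12
      rw [hIH] at hS
      push_cast at hS ⊢
      rw [inv_inv] at hS
      linear_combination -hS - hlog / 2 + Real.pi * Complex.I * hrecC - Real.pi * hrat

theorem theorem2p4 (z : ℂ) (hz : 0 < z.re) (α : ℝ) (hα : 0 < α)
    (h k H : ℤ) (hk : 0 < k) (hgcd : Int.gcd h k = 1) (hH : h * H ≡ -1 [ZMOD k])
    (x x' : ℂ)
    (hx : x = Complex.exp (2 * Real.pi / k * (Complex.I * h - z / k)))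
    (hx' : x' = Complex.exp (2 * Real.pi / k * (Complex.I * H - k / z))) :
    -- both infinite products converge, and the functional equation holds
    Multipliable (genFactor α x) ∧ Multipliable (genFactor α x') ∧
    partitionGenPow α x =
      Complex.exp (Real.pi * Complex.I * α * dedekindSum h k) *
        powBranch (z / k) (α / 2) *
        Complex.exp (α * Real.pi / (12 * k) * (k / z - z / k)) *
        partitionGenPow α x' := by
  lift k to ℕ using hk.le
  replace hk : 0 < k := by exact_mod_cast hk
  have hk0 : (k : ℂ) ≠ 0 := by exact_mod_cast hk.ne'
  have hw : 0 < (z / k).re := by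
    rw [Complex.div_natCast_re]
    exact div_pos hz (by exact_mod_cast hk)
  have him : ∀ (a : ℤ) {w : ℂ}, 0 < w.re → 0 < ((a + Complex.I * w) / k).im := by
    intro a w hw
    rw [Complex.div_natCast_im]
    exact div_pos (by simpa using hw) (by exact_mod_cast hk)
  have ex : x = Complex.exp (2 * Real.pi * Complex.I * ((h + Complex.I * (z / k)) / k)) := by
    rw [hx]
    congr 1
    push_cast
    linear_combination (-2 * Real.pi * z / k ^ 2 : ℂ) * Complex.I_sq
  have ex' : x' = Complex.exp (2 * Real.pi * Complex.I * ((H + Complex.I * (z / k)⁻¹) / k)) := by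
    rw [hx', inv_div]
    congr 1
    push_cast
    linear_combination (-2 * Real.pi * (k / z) / k : ℂ) * Complex.I_sq
  have hxn : ‖x‖ < 1 := ex ▸ norm_exp_two_pi_I_mul_lt_one (him h hw)
  have hxn' : ‖x'‖ < 1 := ex' ▸ norm_exp_two_pi_I_mul_lt_one (him H (re_inv_pos hw))
  refine ⟨(hasProd_genFactor hxn α).multipliable, (hasProd_genFactor hxn' α).multipliable, ?_⟩
  have key := eulerLog_transformation k hk h H hH hw
  rw [← ex, ← ex', inv_div] at key
  rw [partitionGenPow, partitionGenPow, (hasProd_genFactor hxn α).tprod_eq,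
    (hasProd_genFactor hxn' α).tprod_eq, powBranch]
  push_cast
  rw [logBranch_eq_log hw, ← Complex.exp_add, ← Complex.exp_add, ← Complex.exp_add, key]
  congr 1
  ring
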